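/- Let $f,g:[0,1]\to[0,\infty)$ satisfy: $f(0)=g(0)=f(1)=g(1)=0$; the functions $u\mapsto f(u)+u$ and $u\mapsto g(u)+u$ are nondecreasing on $[0,1]$; and $u\mapsto f(u)/u$ and $u\mapsto g(u)/u$ are nonincreasing on $(0,1]$. Let \[C(u,v)=C_{f,g}(u,v)=\max\{0,\;uv-f(u)g(v)\},\qquad (u,v)\in[0,1]^2,\] be the corresponding reflected maxmin (RMM) copula. There is a unique Borel measure $\mu$ on $\mathbb R^2$ that is concentrated on $[0,1]^2$ and satisfies $\mu([0,u]\times[0,v])=C(u,v)$ for all $u,v\in[0,1]$; absolute continuity, density and singular part of $C$ are those of $\mu$ with respect to Lebesgue measure $\lambda$ on $\mathbb R^2$. Let the stand $\mathcal S$ be the closure of $\{(u,v)\in[0,1]^2: C(u,v)>0\}$, let the zero set $\mathcal Z$ be the closure of $[0,1]^2\setminus\mathcal S$, and let the boundary level set $L_0$ be $\mathcal S\cap\mathcal Z\cap(0,1)^2$ if this intersection is nonempty, and $\{(t,0),(0,t):t\in[0,1]\}$ otherwise. Theorem. The functions $f$ and $g$ are differentiable almost everywhere on $[0,1]$, and the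 function $1-f'(u)g'(v)$ is nonnegative $\lambda$-almost everywhere on $\mathcal S$ and integrable on $\mathcal S$. The copula $C$ is absolutely continuous in the interior of $\mathcal S$ and in the interior of $\mathcal Z$. The density of the absolutely continuous part of $\mu$ is $1-f'(u)g'(v)$ for $\lambda$-almost every $(u,v)\in\mathcal S$ and $0$ for $\lambda$-almost every $(u,v)\in\mathcal Z$. Moreover, for every rectangle $[a,c]\times[b,d]$ contained in the interior of $\mathcal S$, \[\iint_{[a,c]\times[b,d]}\bigl(1-f'(u)g'(v)\bigr)\,du\,dv=C(c,d)-C(c,b)-C(a,d)+C(a,b),\] and for every rectangle contained in the interior of $\mathcal Z$ the right-hand side is $0$. Consequently the singular part of $\mu$ is concentrated on $L_0$: it vanishes on $\mathbb R^2\setminus L_0$. -/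

import Mathlib

open MeasureTheory Set
open scoped ENNReal

namespace RMM

/-- A generator of a reflected maxmin copula: a function `f : [0,1] → [0,∞)` with `f 0 = f 1 = 0`
such that `u ↦ f u + u` is nondecreasing on `[0,1]` and `u ↦ f u / u` is nonincreasing on `(0,1]`.
Only the values of `f` on `[0,1]` matter. -/
structure IsGenerator (f : ℝ → ℝ) : Prop where
  nonneg : ∀ u ∈ Icc (0 : ℝ) 1, 0 ≤ f u
  map_zero : f 0 = 0
  map_one : f 1 = 0
  monotoneOn_hat : MonotoneOn (fun u => f u + u) (Icc 0 1)
  antitoneOn_star : AntitoneOn (fun u => f u / u) (Ioc 0 1)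

/-- The reflected maxmin copula `C_{f,g}(u,v) = max {0, uv - f(u) g(v)}` (used on `[0,1]²`). -/
noncomputable def copula (f g : ℝ → ℝ) (u v : ℝ) : ℝ :=
  max 0 (u * v - f u * g v)

/-- The closed unit square `[0,1]²`. -/
def unitSquare : Set (ℝ × ℝ) := Icc 0 1 ×ˢ Icc 0 1

/-- The stand of `C`: the closure of `{(u,v) ∈ [0,1]² : C(u,v) > 0}`. -/
def stand (C : ℝ → ℝ → ℝ) : Set (ℝ × ℝ) :=
  closure {p | p ∈ unitSquare ∧ 0 < C p.1 p.2}

/-- The zero set of `C`: the closure of the complement of the stand in `[0,1]²`. -/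
def zeroSet (C : ℝ → ℝ → ℝ) : Set (ℝ × ℝ) :=
  closure (unitSquare \ stand C)

/-- The part of the common boundary of the stand and the zero set in the open square `(0,1)²`. -/
def innerBoundary (C : ℝ → ℝ → ℝ) : Set (ℝ × ℝ) :=
  stand C ∩ zeroSet C ∩ (Ioo 0 1 ×ˢ Ioo 0 1)

open Classical in
/-- The boundary level set `L₀(C)`: the inner boundary if this is nonempty, and otherwise (for the
copulas considered here: if the stand is all of `[0,1]²`) the two sides of the square on the
coordinate axes. -/
noncomputable def levelZero (C : ℝ → ℝ → ℝ) : Set (ℝ × ℝ) :=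
  if (innerBoundary C).Nonempty then innerBoundary C
  else {p | p ∈ unitSquare ∧ (p.1 = 0 ∨ p.2 = 0)}

/-- `μ` is the measure induced by the copula `C`: the Borel measure on `ℝ²` that is concentrated on
`[0,1]²` and satisfies `μ([0,u] × [0,v]) = C(u,v)` for all `u, v ∈ [0,1]`. -/
structure IsInducedBy (μ : Measure (ℝ × ℝ)) (C : ℝ → ℝ → ℝ) : Prop where
  compl_null : μ unitSquareᶜ = 0
  apply_box : ∀ u ∈ Icc (0 : ℝ) 1, ∀ v ∈ Icc (0 : ℝ) 1,
    μ (Icc 0 u ×ˢ Icc 0 v) = ENNReal.ofReal (C u v)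

/-- The function `(u,v) ↦ 1 - f'(u) g'(v)`. -/
noncomputable def standDensity (f g : ℝ → ℝ) (p : ℝ × ℝ) : ℝ :=
  1 - deriv f p.1 * deriv g p.2

end RMM

namespace RMM

/-! ### Generators -/

namespace IsGenerator

variable {f g : ℝ → ℝ}

/-! The measure is written down explicitly, by differentiating `C` first in `u` and then in `v`.
Since `f(u)/u` and `g(v)/v` are nonincreasing, the set where `f(u)g(v) < uv` in the open square is
closed under increasing coordinates, so it is the region above an antitone curve `φ` (`threshold`).

Each slice `C(·,v)` is 1-Lipschitz, hence the integral of its derivative, which for almost every `s`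
is `v - f'(s)g(v)` if `φ(s) ≤ v` and `0` otherwise (`lintegral_deriv_copula`). As a function of `v`
this derivative jumps by `φ(s) - f'(s)g(φ(s)) ≥ 0` at `φ(s)`, and above `φ(s)` it grows by the
integral of `1 - f'(s)g'(t)`, because `g` is Lipschitz there unless `f(s) = 0`. The jumps give a
measure on the graph of `φ`, the growth gives a density on the region, and their sum has
distribution function `C` (`inducedMeasure_box`).

The graph of `φ` is Lebesgue-null, so this sum is the Lebesgue decomposition, and uniqueness
(`IsInducedBy.eq`) transfers it to every induced measure. The topology is then matched to `φ`: the
interior of the stand is the region (`interior_stand`), the rest of the stand is null because `φ`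
has countably many jumps (`volume_stand_diff`), and points of the curve at positive height lie on
the inner boundary, while those at height zero carry no mass because `g(0) = 0`. -/

lemma sub_le_sub (hf : IsGenerator f) {x y : ℝ} (hx : 0 ≤ x) (hxy : x ≤ y) (hy : y ≤ 1) :
    f x - f y ≤ y - x := by
  have := hf.monotoneOn_hat ⟨hx, hxy.trans hy⟩ ⟨hx.trans hxy, hy⟩ hxy
  simp only at this
  linarith

lemma le_one_sub (hf : IsGenerator f) {x : ℝ} (hx : x ∈ Icc (0 : ℝ) 1) : f x ≤ 1 - x := by
  have := hf.sub_le_sub hx.1 hx.2 le_rfl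
  rw [hf.map_one] at this
  linarith

lemma mul_le_mul (hf : IsGenerator f) {x y : ℝ} (hx : 0 ≤ x) (hxy : x ≤ y) (hy : y ≤ 1) :
    f y * x ≤ f x * y := by
  rcases hx.eq_or_lt with rfl | hx
  · simp [hf.map_zero]
  have hy0 := hx.trans_le hxy
  have := hf.antitoneOn_star ⟨hx, hxy.trans hy⟩ ⟨hy0, hy⟩ hxy
  simp only at this
  rwa [div_le_div_iff₀ hy0 hx] at this

/-- A generator dominated by a linear function on `[a, 1]` is Lipschitz there. -/
lemma lipschitzOnWith (hf : IsGenerator f) {a : ℝ} {M : NNReal} (ha : 0 ≤ a) (hM : 1 ≤ M)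
    (h : ∀ x ∈ Icc a 1, f x ≤ M * x) : LipschitzOnWith M f (Icc a 1) := by
  have hM' : (1 : ℝ) ≤ M := by exact_mod_cast hM
  have key : ∀ x ∈ Icc a 1, ∀ y ∈ Icc a 1, x ≤ y → |f x - f y| ≤ M * (y - x) := by
    intro x hx y hy hxy
    have hx0 := ha.trans hx.1
    have h1 := hf.sub_le_sub hx0 hxy hy.2
    have h2 := hf.mul_le_mul hx0 hxy hy.2
    rw [abs_le]
    constructor
    -- Antitonicity of `f(u)/u` bounds the growth `f y - f x` by `(f x / x) * (y - x)`; the slope at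
    -- `x = 0` is bounded directly by the linear majorant.
    · rcases hx0.eq_or_lt with rfl | hx0
      · have := h y hy
        rw [hf.map_zero]
        linarith
      · have h3 := h x hx
        have h4 : f y ≤ f x * y / x := by rwa [le_div_iff₀ hx0]
        have h5 : f x * y / x - f x = f x / x * (y - x) := by field_simp
        have h6 : f x / x ≤ M := by rwa [div_le_iff₀ hx0]
        have := mul_le_mul_of_nonneg_right h6 (sub_nonneg.2 hxy)
        linarith
    · nlinarith
  refine LipschitzOnWith.of_dist_le_mul fun x hx y hy => ?_
  rw [Real.dist_eq, Real.dist_eq]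
  rcases le_total x y with hxy | hxy
  · rw [abs_sub_comm x y, abs_of_nonneg (sub_nonneg.2 hxy)]
    exact key x hx y hy hxy
  · rw [abs_sub_comm, abs_of_nonneg (sub_nonneg.2 hxy)]
    exact key y hy x hx hxy

/-- Antitonicity of `f(u)/u` gives the linear majorant `(f a / a) * x` on `[a, 1]`. The restriction
`0 < a` is essential: a generator may jump at `0`. -/
lemma exists_lipschitzOnWith (hf : IsGenerator f) {a : ℝ} (ha : 0 < a) :
    ∃ M, LipschitzOnWith M f (Icc a 1) := by
  rcases lt_or_ge 1 a with h1 | h1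
  · exact ⟨0, by simp [Icc_eq_empty (not_le.2 h1)]⟩
  have hfa := hf.nonneg a ⟨ha.le, h1⟩
  refine ⟨1 + (f a / a).toNNReal, hf.lipschitzOnWith ha.le (by simp) fun x hx => ?_⟩
  have h2 := hf.mul_le_mul ha.le hx.1 hx.2
  have hx0 : 0 < x := ha.trans_le hx.1
  have h3 : f x ≤ f a / a * x := by
    rw [div_mul_eq_mul_div, le_div_iff₀ ha]
    linarith
  rw [NNReal.coe_add, NNReal.coe_one, Real.coe_toNNReal _ (by positivity)]
  linarith

lemma continuousAt (hf : IsGenerator f) {x : ℝ} (hx : x ∈ Ioo (0 : ℝ) 1) : ContinuousAt f x := by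
  obtain ⟨M, hM⟩ := hf.exists_lipschitzOnWith (half_pos hx.1)
  exact hM.continuousOn.continuousAt (Icc_mem_nhds (by linarith [hx.1]) hx.2)

lemma ae_differentiableAt (hf : IsGenerator f) :
    ∀ᵐ u ∂(volume.restrict (Icc (0 : ℝ) 1)), DifferentiableAt ℝ f u := by
  have h := hf.monotoneOn_hat.ae_differentiableWithinAt measurableSet_Icc
  rw [ae_restrict_iff' measurableSet_Icc] at h ⊢
  filter_upwards [h, (countable_singleton (0 : ℝ)).ae_notMem volume,
    (countable_singleton (1 : ℝ)).ae_notMem volume] with x hx h0 h1 hx01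
  have hx' := (hx hx01).differentiableAt
    (Icc_mem_nhds (lt_of_le_of_ne hx01.1 (Ne.symm h0)) (lt_of_le_of_ne hx01.2 h1))
  simpa using hx'.sub differentiableAt_id

lemma neg_one_le_deriv (hf : IsGenerator f) {x : ℝ} (hx : x ∈ Ioo (0 : ℝ) 1)
    (hd : DifferentiableAt ℝ f x) : -1 ≤ deriv f x := by
  have h1 : HasDerivAt (fun u => f u + u) (deriv f x + 1) x := hd.hasDerivAt.add (hasDerivAt_id x)
  have h2 := (hf.monotoneOn_hat).derivWithin_nonneg (x := x)
  rw [derivWithin_of_mem_nhds (Icc_mem_nhds hx.1 hx.2), h1.deriv] at h2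
  linarith

lemma deriv_mul_le (hf : IsGenerator f) {x : ℝ} (hx : x ∈ Ioo (0 : ℝ) 1)
    (hd : DifferentiableAt ℝ f x) : deriv f x * x ≤ f x := by
  have h1 : HasDerivAt (fun u => f u / u) ((deriv f x * x - f x * 1) / x ^ 2) x :=
    hd.hasDerivAt.div (hasDerivAt_id x) hx.1.ne'
  have h2 := (hf.antitoneOn_star).derivWithin_nonpos (x := x)
  rw [derivWithin_of_mem_nhds (Ioc_mem_nhds hx.1 hx.2), h1.deriv,
    div_le_iff₀ (by have := hx.1; positivity)] at h2
  linarith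

lemma deriv_eq_zero (hf : IsGenerator f) {x : ℝ} (hx : x ∈ Ioo (0 : ℝ) 1) (h0 : f x = 0) :
    deriv f x = 0 := by
  apply IsLocalMin.deriv_eq_zero
  filter_upwards [Icc_mem_nhds hx.1 hx.2] with y hy
  rw [h0]
  exact hf.nonneg y hy

/-- The strict inequality defining the region where the copula is positive propagates upwards. -/
lemma mul_lt_mul_of_le (hf : IsGenerator f) (hg : IsGenerator g) {x y x' y' : ℝ} (hx : 0 < x)
    (hy : 0 < y) (hx' : x ≤ x') (hy' : y ≤ y') (hx1 : x' ≤ 1) (hy1 : y' ≤ 1)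
    (h : f x * g y < x * y) : f x' * g y' < x' * y' := by
  have h1 := hf.mul_le_mul hx.le hx' hx1
  have h2 := hg.mul_le_mul hy.le hy' hy1
  have hx0 := hx.trans_le hx'
  have hy0 := hy.trans_le hy'
  have h3 : (f x' * x) * (g y' * y) ≤ (f x * x') * (g y * y') :=
    _root_.mul_le_mul h1 h2 (mul_nonneg (hg.nonneg _ ⟨hy0.le, hy1⟩) hy.le)
      (mul_nonneg (hf.nonneg _ ⟨hx.le, hx'.trans hx1⟩) hx0.le)
  have h4 : (f x * g y) * (x' * y') < (x * y) * (x' * y') := by gcongr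
  have h5 : (f x' * g y') * (x * y) < (x' * y') * (x * y) := by linarith
  exact lt_of_mul_lt_mul_right h5 (by positivity)

end IsGenerator

/-! ### The region of positivity and its lower boundary curve -/

/-- The part of the open unit square on which the copula `C_{f,g}` is positive. -/
def positiveRegion (f g : ℝ → ℝ) : Set (ℝ × ℝ) :=
  {p | p.1 ∈ Ioo (0 : ℝ) 1 ∧ p.2 ∈ Ioo (0 : ℝ) 1 ∧ f p.1 * g p.2 < p.1 * p.2}

/-- The curve bounding the region of positivity from below. -/
noncomputable def threshold (f g : ℝ → ℝ) (s : ℝ) : ℝ :=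
  sInf {v | (s, v) ∈ positiveRegion f g}

variable {f g : ℝ → ℝ}

lemma bddBelow_section (f g : ℝ → ℝ) (s : ℝ) : BddBelow {v | (s, v) ∈ positiveRegion f g} :=
  ⟨0, fun _ hv => hv.2.1.1.le⟩

/-- Both generators lie below `1 - u`, and `(1 - s)(1 - v) < sv` exactly when `s + v > 1`. This
keeps the threshold below `1`. -/
lemma mem_positiveRegion_of_lt_add (hf : IsGenerator f) (hg : IsGenerator g) {s v : ℝ}
    (hs : s ∈ Ioo (0 : ℝ) 1) (hv : v ∈ Ioo (0 : ℝ) 1) (h : 1 < s + v) :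
    (s, v) ∈ positiveRegion f g := by
  refine ⟨hs, hv, ?_⟩
  have h1 := hf.le_one_sub ⟨hs.1.le, hs.2.le⟩
  have h2 := hg.le_one_sub ⟨hv.1.le, hv.2.le⟩
  have h3 := mul_le_mul h1 h2 (hg.nonneg _ ⟨hv.1.le, hv.2.le⟩) (by linarith [hs.2])
  simp only
  nlinarith

lemma section_nonempty (hf : IsGenerator f) (hg : IsGenerator g) {s : ℝ}
    (hs : s ∈ Ioo (0 : ℝ) 1) : {v | (s, v) ∈ positiveRegion f g}.Nonempty :=
  ⟨1 - s / 2, mem_positiveRegion_of_lt_add hf hg hs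
    ⟨by linarith [hs.1, hs.2], by linarith [hs.1]⟩ (by linarith [hs.1])⟩

lemma threshold_nonneg (f g : ℝ → ℝ) (s : ℝ) : 0 ≤ threshold f g s :=
  Real.sInf_nonneg fun _ hv => hv.2.1.1.le

/-- The section is empty and `sInf ∅ = 0`. With this default the curve density vanishes outside
`(0,1)`, because `g 0 = 0`. -/
lemma threshold_eq_zero {s : ℝ} (hs : s ∉ Ioo (0 : ℝ) 1) : threshold f g s = 0 := by
  have : {v | (s, v) ∈ positiveRegion f g} = ∅ := eq_empty_of_forall_notMem fun v hv => hs hv.1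
  rw [threshold, this, Real.sInf_empty]

lemma threshold_lt_one (hf : IsGenerator f) (hg : IsGenerator g) (s : ℝ) :
    threshold f g s < 1 := by
  by_cases hs : s ∈ Ioo (0 : ℝ) 1
  · obtain ⟨v, hv⟩ := section_nonempty hf hg hs
    exact (csInf_le (bddBelow_section f g s) hv).trans_lt hv.2.1.2
  · rw [threshold_eq_zero hs]
    exact one_pos

lemma threshold_mem_Icc (hf : IsGenerator f) (hg : IsGenerator g) (s : ℝ) :
    threshold f g s ∈ Icc (0 : ℝ) 1 :=
  ⟨threshold_nonneg f g s, (threshold_lt_one hf hg s).le⟩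

lemma isOpen_positiveRegion (hf : IsGenerator f) (hg : IsGenerator g) :
    IsOpen (positiveRegion f g) := by
  rw [isOpen_iff_mem_nhds]
  rintro ⟨s, v⟩ ⟨hs, hv, h⟩
  have h1 : ContinuousAt (fun p : ℝ × ℝ => f p.1 * g p.2) (s, v) :=
    (ContinuousAt.comp (x := (s, v)) (g := f) (hf.continuousAt hs) continuousAt_fst).mul
      (ContinuousAt.comp (x := (s, v)) (g := g) (hg.continuousAt hv) continuousAt_snd)
  have h2 : ContinuousAt (fun p : ℝ × ℝ => p.1 * p.2) (s, v) := by fun_prop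
  filter_upwards [continuousAt_fst (isOpen_Ioo.mem_nhds hs),
    continuousAt_snd (isOpen_Ioo.mem_nhds hv), h1.eventually_lt h2 h] with p hp1 hp2 hp3
  exact ⟨hp1, hp2, hp3⟩

lemma mem_positiveRegion_of_threshold_lt (hf : IsGenerator f) (hg : IsGenerator g) {s v : ℝ}
    (hs : s ∈ Ioo (0 : ℝ) 1) (hv : v < 1) (h : threshold f g s < v) :
    (s, v) ∈ positiveRegion f g := by
  obtain ⟨w, hw, hwv⟩ := exists_lt_of_csInf_lt (section_nonempty hf hg hs) h
  exact ⟨hs, ⟨hw.2.1.1.trans hwv, hv⟩,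
    hf.mul_lt_mul_of_le hg hs.1 hw.2.1.1 le_rfl hwv.le hs.2.le hv.le hw.2.2⟩

lemma threshold_lt_of_mem_positiveRegion (hf : IsGenerator f) (hg : IsGenerator g) {s v : ℝ}
    (h : (s, v) ∈ positiveRegion f g) : threshold f g s < v := by
  -- The section is open, so its infimum is not attained.
  have h1 : ∀ᶠ w in nhds v, (s, w) ∈ positiveRegion f g :=
    (Continuous.prodMk_right s).continuousAt ((isOpen_positiveRegion hf hg).mem_nhds h)
  obtain ⟨w, hwv, hw⟩ := (h1.filter_mono nhdsWithin_le_nhds |>.and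
    (self_mem_nhdsWithin : Iio v ∈ nhdsWithin v (Iio v))).exists
  exact (csInf_le (bddBelow_section f g s) hwv).trans_lt hw

lemma mem_positiveRegion_iff (hf : IsGenerator f) (hg : IsGenerator g) {s v : ℝ}
    (hs : s ∈ Ioo (0 : ℝ) 1) :
    (s, v) ∈ positiveRegion f g ↔ v ∈ Ioo (threshold f g s) 1 :=
  ⟨fun h => ⟨threshold_lt_of_mem_positiveRegion hf hg h, h.2.1.2⟩,
    fun h => mem_positiveRegion_of_threshold_lt hf hg hs h.2 h.1⟩

lemma mul_lt_mul_of_threshold_lt (hf : IsGenerator f) (hg : IsGenerator g) {s v : ℝ}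
    (hs : s ∈ Ioo (0 : ℝ) 1) (hv : v ≤ 1) (h : threshold f g s < v) : f s * g v < s * v := by
  rcases hv.eq_or_lt with rfl | hv
  · rw [hg.map_one, mul_zero, mul_one]
    exact hs.1
  · exact (mem_positiveRegion_of_threshold_lt hf hg hs hv h).2.2

lemma mul_le_mul_of_lt_threshold (hf : IsGenerator f) (hg : IsGenerator g) {s v : ℝ}
    (hs : s ∈ Ioo (0 : ℝ) 1) (hv : 0 ≤ v) (h : v < threshold f g s) : s * v ≤ f s * g v := by
  rcases hv.eq_or_lt with rfl | hv
  · simp [hg.map_zero]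
  · by_contra! h'
    exact h.not_gt (threshold_lt_of_mem_positiveRegion hf hg
      ⟨hs, ⟨hv, h.trans (threshold_lt_one hf hg s)⟩, h'⟩)

/-- Opposite inequalities hold just above and just below the threshold, and `g` is continuous there
if it is positive. At threshold `0`, where `g` may jump, both sides vanish. -/
lemma mul_threshold (hf : IsGenerator f) (hg : IsGenerator g) {s : ℝ} (hs : s ∈ Ioo (0 : ℝ) 1) :
    f s * g (threshold f g s) = s * threshold f g s := by
  rcases (threshold_nonneg f g s).eq_or_lt with h0 | h0
  · rw [← h0, hg.map_zero, mul_zero, mul_zero]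
  have h1 := threshold_lt_one hf hg s
  set t := threshold f g s with ht
  have hc1 : ContinuousAt (fun v => f s * g v) t := (hg.continuousAt ⟨h0, h1⟩).const_mul _
  have hc2 : ContinuousAt (fun v => s * v) t := by fun_prop
  apply le_antisymm
  · refine le_of_tendsto_of_tendsto (hc1.tendsto.mono_left nhdsWithin_le_nhds)
      (hc2.tendsto.mono_left nhdsWithin_le_nhds) (b := nhdsWithin t (Ioi t)) ?_
    filter_upwards [Ioo_mem_nhdsGT h1] with v hv
    exact (mul_lt_mul_of_threshold_lt hf hg hs hv.2.le hv.1).le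
  · refine le_of_tendsto_of_tendsto (hc2.tendsto.mono_left nhdsWithin_le_nhds)
      (hc1.tendsto.mono_left nhdsWithin_le_nhds) (b := nhdsWithin t (Iio t)) ?_
    filter_upwards [Ioo_mem_nhdsLT h0] with v hv
    exact mul_le_mul_of_lt_threshold hf hg hs hv.1.le hv.2

lemma mul_le_mul_of_threshold_le (hf : IsGenerator f) (hg : IsGenerator g) {s v : ℝ}
    (hs : s ∈ Ioo (0 : ℝ) 1) (hv : v ≤ 1) (h : threshold f g s ≤ v) : f s * g v ≤ s * v := by
  rcases h.eq_or_lt with rfl | h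
  · exact (mul_threshold hf hg hs).le
  · exact (mul_lt_mul_of_threshold_lt hf hg hs hv h).le

lemma antitoneOn_threshold (hf : IsGenerator f) (hg : IsGenerator g) :
    AntitoneOn (threshold f g) (Ioo 0 1) := by
  intro s hs s' hs' hss'
  refine csInf_le_csInf (bddBelow_section f g s') (section_nonempty hf hg hs) fun v hv => ?_
  exact ⟨hs', hv.2.1, hf.mul_lt_mul_of_le hg hs.1 hv.2.1.1 hss' le_rfl hs'.2.le hv.2.1.2.le hv.2.2⟩

lemma measurable_of_antitoneOn_of_eq {F : ℝ → ℝ} {A : Set ℝ} (hA : MeasurableSet A) {c : ℝ}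
    (hF : AntitoneOn F A) (h : ∀ s ∉ A, F s = c) : Measurable F := by
  refine measurable_of_restrict_of_restrict_compl hA ?_ ?_
  · exact Antitone.measurable fun x y hxy => hF x.2 y.2 hxy
  · have : Aᶜ.domRestrict F = fun _ => c := funext fun x => h x x.2
    rw [this]
    exact measurable_const

lemma measurable_threshold (hf : IsGenerator f) (hg : IsGenerator g) :
    Measurable (threshold f g) :=
  measurable_of_antitoneOn_of_eq measurableSet_Ioo (antitoneOn_threshold hf hg)
    fun _ hs => threshold_eq_zero hs

/-- Since `g` is arbitrary outside `[0,1]`, its measurability is not available; instead `g + id` is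
monotone on `[0,1]`, so its composite with the antitone threshold is antitone on `(0,1)`. -/
lemma measurable_comp_threshold (hf : IsGenerator f) (hg : IsGenerator g) :
    Measurable fun s => g (threshold f g s) := by
  have h : Measurable fun s => g (threshold f g s) + threshold f g s := by
    refine measurable_of_antitoneOn_of_eq (A := Ioo 0 1) (c := 0) measurableSet_Ioo ?_ fun s hs => ?_
    · intro s hs s' hs' hss'
      exact hg.monotoneOn_hat (threshold_mem_Icc hf hg s') (threshold_mem_Icc hf hg s)
        (antitoneOn_threshold hf hg hs hs' hss')
    · rw [threshold_eq_zero hs, hg.map_zero, add_zero]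
  convert h.sub (measurable_threshold hf hg) using 1
  ext s
  simp

/-! ### The density on the region of positivity -/

/-- Combines `f'(s)s ≤ f(s)` with `f(s)g(v) ≤ sv`. It makes the slice derivative, and at `v =
threshold f g s` the curve density, nonnegative, so `ENNReal.ofReal` truncates nothing. -/
lemma deriv_mul_le_of_threshold_le (hf : IsGenerator f) (hg : IsGenerator g) {s v : ℝ}
    (hs : s ∈ Ioo (0 : ℝ) 1) (hd : DifferentiableAt ℝ f s) (hv : v ≤ 1)
    (h : threshold f g s ≤ v) : deriv f s * g v ≤ v := by
  have hv0 := (threshold_nonneg f g s).trans h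
  have h1 := hf.deriv_mul_le hs hd
  have h2 := mul_le_mul_of_threshold_le hf hg hs hv h
  have h3 := mul_le_mul_of_nonneg_right h1 (hg.nonneg v ⟨hv0, hv⟩)
  have hs0 := hs.1
  nlinarith

lemma standDensity_nonneg (hf : IsGenerator f) (hg : IsGenerator g) {p : ℝ × ℝ}
    (hp : p ∈ positiveRegion f g) (hdf : DifferentiableAt ℝ f p.1)
    (hdg : DifferentiableAt ℝ g p.2) : 0 ≤ standDensity f g p := by
  obtain ⟨hs, hv, h⟩ := hp
  have h1 := hf.neg_one_le_deriv hs hdf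
  have h2 := hg.neg_one_le_deriv hv hdg
  have h3 := hf.deriv_mul_le hs hdf
  have h4 := hg.deriv_mul_le hv hdg
  rw [standDensity, sub_nonneg]
  -- Two nonnegative derivatives satisfy `f'g'·uv ≤ f(u)g(v) < uv`; two nonpositive ones lie in
  -- `[-1,0]`; mixed signs give a nonpositive product.
  rcases le_total 0 (deriv f p.1) with h5 | h5 <;> rcases le_total 0 (deriv g p.2) with h6 | h6
  · have h7 := _root_.mul_le_mul h3 h4 (mul_nonneg h6 hv.1.le)
      (hf.nonneg _ ⟨hs.1.le, hs.2.le⟩)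
    have h8 : deriv f p.1 * deriv g p.2 * (p.1 * p.2) ≤ 1 * (p.1 * p.2) := by linarith
    exact le_of_mul_le_mul_right h8 (mul_pos hs.1 hv.1)
  · exact (mul_nonpos_of_nonneg_of_nonpos h5 h6).trans zero_le_one
  · exact (mul_nonpos_of_nonpos_of_nonneg h5 h6).trans zero_le_one
  · nlinarith

lemma IsGenerator.ae_differentiableAt_of_mem (hf : IsGenerator f) :
    ∀ᵐ u : ℝ, u ∈ Icc (0 : ℝ) 1 → DifferentiableAt ℝ f u :=
  (ae_restrict_iff' measurableSet_Icc).1 hf.ae_differentiableAt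

lemma ae_ne_real (a : ℝ) : ∀ᵐ u : ℝ, u ≠ a :=
  (countable_singleton a).ae_notMem volume

lemma measurable_standDensity (f g : ℝ → ℝ) : Measurable (standDensity f g) :=
  measurable_const.sub (((measurable_deriv f).comp measurable_fst).mul
    ((measurable_deriv g).comp measurable_snd))

/-! ### Integrating the density along vertical lines -/

/-- Above the threshold `f(s)g(t) ≤ st`, so `g` has the linear majorant `(s / f s) * t` and is
Lipschitz, even when the threshold is `0`. -/
lemma absolutelyContinuousOnInterval_of_threshold_le (hf : IsGenerator f) (hg : IsGenerator g)
    {s v : ℝ} (hs : s ∈ Ioo (0 : ℝ) 1) (hv : v ≤ 1) (h : threshold f g s ≤ v) (h0 : f s ≠ 0) :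
    AbsolutelyContinuousOnInterval g (threshold f g s) v := by
  have hfs : 0 < f s := lt_of_le_of_ne (hf.nonneg s ⟨hs.1.le, hs.2.le⟩) (Ne.symm h0)
  have hM : LipschitzOnWith (max 1 (s / f s).toNNReal) g (Icc (threshold f g s) 1) := by
    refine hg.lipschitzOnWith (threshold_nonneg f g s) (le_max_left _ _) fun t ht => ?_
    have h1 := mul_le_mul_of_threshold_le hf hg hs ht.2 ht.1
    have h2 : g t ≤ s / f s * t := by
      rw [div_mul_eq_mul_div, le_div_iff₀ hfs]
      linarith
    refine h2.trans (mul_le_mul_of_nonneg_right ?_ ((threshold_nonneg f g s).trans ht.1))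
    rw [NNReal.coe_max]
    exact (Real.le_coe_toNNReal _).trans (le_max_right _ _)
  apply LipschitzOnWith.absolutelyContinuousOnInterval
  rw [uIcc_of_le h]
  exact hM.mono (Icc_subset_Icc_right hv)

lemma integral_standDensity_section (hf : IsGenerator f) (hg : IsGenerator g) {s v : ℝ}
    (hs : s ∈ Ioo (0 : ℝ) 1) (hv : v ≤ 1) (h : threshold f g s ≤ v) :
    IntervalIntegrable (fun t => standDensity f g (s, t)) volume (threshold f g s) v ∧
    ∫ t in threshold f g s..v, standDensity f g (s, t) =
      (v - deriv f s * g v) - (threshold f g s - deriv f s * g (threshold f g s)) := by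
  simp only [standDensity]
  -- Here `g` may fail to be continuous at the threshold `0`, but `s` is a minimum of `f`, so `f'(s)
  -- = 0` and `g` drops out.
  by_cases h0 : f s = 0
  · simp [hf.deriv_eq_zero hs h0]
  · have hac := absolutelyContinuousOnInterval_of_threshold_le hf hg hs hv h h0
    have hi := hac.intervalIntegrable_deriv.const_mul (deriv f s)
    have hc : IntervalIntegrable (fun _ : ℝ => (1 : ℝ)) volume (threshold f g s) v :=
      intervalIntegrable_const
    refine ⟨hc.sub hi, ?_⟩
    rw [intervalIntegral.integral_sub hc hi, intervalIntegral.integral_const_mul,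
      hac.integral_deriv_eq_sub, intervalIntegral.integral_const]
    simp only [smul_eq_mul]
    ring

lemma standDensity_section_nonneg (hf : IsGenerator f) (hg : IsGenerator g) {s v : ℝ}
    (hs : s ∈ Ioo (0 : ℝ) 1) (hd : DifferentiableAt ℝ f s) (hv : v ≤ 1) :
    0 ≤ᵐ[volume.restrict (Ioc (threshold f g s) v)] fun t => standDensity f g (s, t) := by
  refine (ae_restrict_iff' measurableSet_Ioc).2 ?_
  filter_upwards [hg.ae_differentiableAt_of_mem, ae_ne_real 1] with t ht ht1 ht2
  have ht3 : t < 1 := lt_of_le_of_ne (ht2.2.trans hv) ht1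
  exact standDensity_nonneg hf hg (mem_positiveRegion_of_threshold_lt hf hg hs ht3 ht2.1) hd
    (ht ⟨(threshold_nonneg f g s).trans ht2.1.le, ht3.le⟩)

lemma lintegral_standDensity_section (hf : IsGenerator f) (hg : IsGenerator g) {s v : ℝ}
    (hs : s ∈ Ioo (0 : ℝ) 1) (hd : DifferentiableAt ℝ f s) (hv : v ≤ 1)
    (h : threshold f g s ≤ v) :
    ∫⁻ t in Ioc (threshold f g s) v, ENNReal.ofReal (standDensity f g (s, t)) =
      ENNReal.ofReal ((v - deriv f s * g v) -
        (threshold f g s - deriv f s * g (threshold f g s))) := by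
  obtain ⟨h1, h2⟩ := integral_standDensity_section hf hg hs hv h
  rw [← h2, intervalIntegral.integral_of_le h, ofReal_integral_eq_lintegral_ofReal
    ((intervalIntegrable_iff_integrableOn_Ioc_of_le h).1 h1)
    (standDensity_section_nonneg hf hg hs hd hv)]

/-! ### Horizontal slices of the copula -/

/-- An increment of `sv - f(s)g(v)` is at most `(y - x)(v + g(v)) ≤ y - x`. The slice is
nondecreasing because, where positive, it is `s` times the nondecreasing factor `v - (f(s)/s)g(v)`.
-/
lemma lipschitzOnWith_copula (hf : IsGenerator f) (hg : IsGenerator g) {v : ℝ}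
    (hv : v ∈ Icc (0 : ℝ) 1) : LipschitzOnWith 1 (fun s => copula f g s v) (Icc 0 1) := by
  have hg0 := hg.nonneg v hv
  have hg1 := hg.le_one_sub hv
  have key : ∀ x ∈ Icc (0 : ℝ) 1, ∀ y ∈ Icc (0 : ℝ) 1, x ≤ y →
      |copula f g x v - copula f g y v| ≤ y - x := by
    intro x hx y hy hxy
    have h1 := hf.sub_le_sub hx.1 hxy hy.2
    have h2 := hf.mul_le_mul hx.1 hxy hy.2
    have hup : copula f g y v ≤ copula f g x v + (y - x) := by
      have h3 : x * v - f x * g v ≤ copula f g x v := le_max_right _ _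
      have h4 : 0 ≤ copula f g x v := le_max_left _ _
      have h5 := mul_le_mul_of_nonneg_right h1 hg0
      have h6 := mul_le_mul_of_nonneg_left hg1 (sub_nonneg.2 hxy)
      exact max_le (by linarith) (by linarith)
    have hmono : copula f g x v ≤ copula f g y v := by
      refine max_le (le_max_left _ _) ?_
      by_cases h3 : x * v - f x * g v ≤ 0
      · exact h3.trans (le_max_left _ _)
      · push Not at h3
        have hx0 : 0 < x := by
          rcases hx.1.eq_or_lt with rfl | h
          · simp [hf.map_zero] at h3
          · exact h
        refine le_trans ?_ (le_max_right _ _)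
        have h4 := mul_le_mul_of_nonneg_right h2 hg0
        have h5 := mul_le_mul_of_nonneg_right hxy h3.le
        refine le_of_mul_le_mul_right ?_ hx0
        linarith
    rw [abs_le]
    constructor <;> linarith
  refine LipschitzOnWith.of_dist_le_mul fun x hx y hy => ?_
  rw [Real.dist_eq, Real.dist_eq, NNReal.coe_one, one_mul]
  rcases le_total x y with hxy | hxy
  · rw [abs_sub_comm x y, abs_of_nonneg (sub_nonneg.2 hxy)]
    exact key x hx y hy hxy
  · rw [abs_sub_comm, abs_of_nonneg (sub_nonneg.2 hxy)]
    exact key y hy x hx hxy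

lemma deriv_copula (hf : IsGenerator f) (hg : IsGenerator g) {s v : ℝ}
    (hs : s ∈ Ioo (0 : ℝ) 1) (hv : v ∈ Icc (0 : ℝ) 1) (hd : DifferentiableAt ℝ f s)
    (hH : DifferentiableAt ℝ (fun s => copula f g s v) s) :
    deriv (fun s => copula f g s v) s =
      if threshold f g s ≤ v then v - deriv f s * g v else 0 := by
  split_ifs with h
  · have hK : HasDerivAt (fun s => s * v - f s * g v) (1 * v - deriv f s * g v) s :=
      ((hasDerivAt_id s).mul_const v).sub (hd.hasDerivAt.mul_const (g v))
    -- The copula dominates `sv - f(s)g(v)` everywhere and touches it at `s`, so the derivatives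
    -- agree; this covers points on the curve too.
    have hmin : IsLocalMin (fun s => copula f g s v - (s * v - f s * g v)) s := by
      refine Filter.Eventually.of_forall fun t => ?_
      have h1 : copula f g s v = s * v - f s * g v :=
        max_eq_right (sub_nonneg.2 (mul_le_mul_of_threshold_le hf hg hs hv.2 h))
      simp only [h1, sub_self]
      exact sub_nonneg.2 (le_max_right _ _)
    have := hmin.hasDerivAt_eq_zero (hH.hasDerivAt.sub hK)
    linarith
  · push Not at h
    refine IsLocalMin.deriv_eq_zero (Filter.Eventually.of_forall fun t => ?_)
    have h1 : copula f g s v = 0 :=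
      max_eq_left (sub_nonpos.2 (mul_le_mul_of_lt_threshold hf hg hs hv.1 h))
    simp only [h1]
    exact le_max_left _ _

lemma lintegral_deriv_copula (hf : IsGenerator f) (hg : IsGenerator g) {u v : ℝ}
    (hu : u ∈ Icc (0 : ℝ) 1) (hv : v ∈ Icc (0 : ℝ) 1) :
    ∫⁻ s in Ioc 0 u, (if threshold f g s ≤ v then ENNReal.ofReal (v - deriv f s * g v) else 0) =
      ENNReal.ofReal (copula f g u v) := by
  have hac : AbsolutelyContinuousOnInterval (fun s => copula f g s v) 0 u := by
    apply LipschitzOnWith.absolutelyContinuousOnInterval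
    rw [uIcc_of_le hu.1]
    exact (lipschitzOnWith_copula hf hg hv).mono (Icc_subset_Icc_right hu.2)
  have hae : ∀ᵐ s ∂volume.restrict (Ioc 0 u), s ∈ Ioo (0 : ℝ) 1 ∧ DifferentiableAt ℝ f s ∧
      deriv (fun s => copula f g s v) s =
        if threshold f g s ≤ v then v - deriv f s * g v else 0 := by
    refine (ae_restrict_iff' measurableSet_Ioc).2 ?_
    filter_upwards [hf.ae_differentiableAt_of_mem, ae_ne_real 1, hac.ae_differentiableAt]
      with s h1 h2 h3 h4
    have hs : s ∈ Ioo (0 : ℝ) 1 := ⟨h4.1, lt_of_le_of_ne (h4.2.trans hu.2) h2⟩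
    have hd := h1 ⟨hs.1.le, hs.2.le⟩
    refine ⟨hs, hd, deriv_copula hf hg hs hv hd (h3 ?_)⟩
    rw [uIcc_of_le hu.1]
    exact ⟨h4.1.le, h4.2⟩
  have h0 : copula f g 0 v = 0 := by simp [copula, hf.map_zero]
  have h1 := hac.integral_deriv_eq_sub
  rw [h0, sub_zero] at h1
  rw [← h1, intervalIntegral.integral_of_le hu.1, ofReal_integral_eq_lintegral_ofReal
    ((intervalIntegrable_iff_integrableOn_Ioc_of_le hu.1).1 hac.intervalIntegrable_deriv)]
  · refine lintegral_congr_ae ?_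
    filter_upwards [hae] with s hs
    rw [hs.2.2]
    split_ifs <;> simp
  · filter_upwards [hae] with s hs
    rw [hs.2.2, Pi.zero_apply]
    split_ifs with h
    · exact sub_nonneg.2 (deriv_mul_le_of_threshold_le hf hg hs.1 hs.2.1 hv.2 h)
    · exact le_rfl

/-! ### The induced measure -/

/-- The density of the absolutely continuous part. -/
noncomputable def regionDensity (f g : ℝ → ℝ) : ℝ × ℝ → ℝ≥0∞ :=
  (positiveRegion f g).indicator fun p => ENNReal.ofReal (standDensity f g p)

/-- The density, with respect to the first coordinate, of the mass on the boundary curve. -/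
noncomputable def curveDensity (f g : ℝ → ℝ) (s : ℝ) : ℝ≥0∞ :=
  ENNReal.ofReal (threshold f g s - deriv f s * g (threshold f g s))

/-- The part of the induced measure carried by the boundary curve. -/
noncomputable def curveMeasure (f g : ℝ → ℝ) : Measure (ℝ × ℝ) :=
  (volume.withDensity (curveDensity f g)).map fun s => (s, threshold f g s)

/-- The measure induced by the copula `C_{f,g}`, as an explicit sum of a singular and an absolutely
continuous part. -/
noncomputable def inducedMeasure (f g : ℝ → ℝ) : Measure (ℝ × ℝ) :=
  curveMeasure f g + volume.withDensity (regionDensity f g)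

lemma measurable_regionDensity (hf : IsGenerator f) (hg : IsGenerator g) :
    Measurable (regionDensity f g) :=
  (measurable_standDensity f g).ennreal_ofReal.indicator
    (isOpen_positiveRegion hf hg).measurableSet

lemma measurable_curveDensity (hf : IsGenerator f) (hg : IsGenerator g) :
    Measurable (curveDensity f g) :=
  ((measurable_threshold hf hg).sub
    ((measurable_deriv f).mul (measurable_comp_threshold hf hg))).ennreal_ofReal

lemma curveMeasure_apply (hf : IsGenerator f) (hg : IsGenerator g) {A : Set (ℝ × ℝ)}
    (hA : MeasurableSet A) :
    curveMeasure f g A = ∫⁻ s in (fun s => (s, threshold f g s)) ⁻¹' A, curveDensity f g s := by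
  rw [curveMeasure, Measure.map_apply (measurable_id'.prodMk (measurable_threshold hf hg)) hA,
    withDensity_apply']

lemma curveMeasure_box (hf : IsGenerator f) (hg : IsGenerator g) (u v : ℝ) :
    curveMeasure f g (Icc 0 u ×ˢ Icc 0 v) =
      ∫⁻ s in Ioc 0 u, if threshold f g s ≤ v then curveDensity f g s else 0 := by
  have hm : MeasurableSet {s | threshold f g s ≤ v} :=
    measurableSet_le (measurable_threshold hf hg) measurable_const
  have h1 : (fun s => (s, threshold f g s)) ⁻¹' (Icc 0 u ×ˢ Icc 0 v) =
      {s | threshold f g s ≤ v} ∩ Icc 0 u := by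
    ext s
    simp only [mem_preimage, mem_prod, mem_Icc, mem_inter_iff, mem_ofPred_eq]
    exact ⟨fun h => ⟨h.2.2, h.1⟩, fun h => ⟨h.2, threshold_nonneg f g s, h.1⟩⟩
  rw [curveMeasure_apply hf hg (measurableSet_Icc.prod measurableSet_Icc), h1,
    ← Measure.restrict_restrict hm, ← lintegral_indicator hm, restrict_Ioc_eq_restrict_Icc]
  refine lintegral_congr fun s => ?_
  simp only [indicator_apply, mem_ofPred_eq]

lemma lintegral_regionDensity_section (hf : IsGenerator f) (hg : IsGenerator g) {s v : ℝ}
    (hs : s ∈ Ioo (0 : ℝ) 1) (hd : DifferentiableAt ℝ f s) (hv : v ∈ Icc (0 : ℝ) 1) :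
    ∫⁻ t in Icc 0 v, regionDensity f g (s, t) =
      if threshold f g s ≤ v then ENNReal.ofReal ((v - deriv f s * g v) -
        (threshold f g s - deriv f s * g (threshold f g s))) else 0 := by
  have h1 : ∀ t, regionDensity f g (s, t) = (Ioo (threshold f g s) 1).indicator
      (fun t => ENNReal.ofReal (standDensity f g (s, t))) t := by
    intro t
    by_cases ht : (s, t) ∈ positiveRegion f g
    · rw [regionDensity, indicator_of_mem ht,
        indicator_of_mem ((mem_positiveRegion_iff hf hg hs).1 ht)]
    · rw [regionDensity, indicator_of_notMem ht,
        indicator_of_notMem (mt (mem_positiveRegion_iff hf hg hs).2 ht)]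
  -- The two sets can differ only at `t = 1`, which matters when `v = 1`.
  have h2 : (Ioo (threshold f g s) 1 ∩ Icc 0 v : Set ℝ) =ᵐ[volume]
      (Ioc (threshold f g s) v : Set ℝ) := by
    refine Filter.eventuallyEq_set.2 ?_
    filter_upwards [ae_ne_real 1] with t ht
    constructor
    · exact fun h => ⟨h.1.1, h.2.2⟩
    · exact fun h => ⟨⟨h.1, lt_of_le_of_ne (h.2.trans hv.2) ht⟩,
        (threshold_nonneg f g s).trans h.1.le, h.2⟩
  simp_rw [h1]
  rw [lintegral_indicator measurableSet_Ioo, Measure.restrict_restrict measurableSet_Ioo,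
    setLIntegral_congr h2]
  split_ifs with h
  · exact lintegral_standDensity_section hf hg hs hd hv.2 h
  · rw [Ioc_eq_empty (fun h' => h h'.le), Measure.restrict_empty, lintegral_zero_measure]

lemma inducedMeasure_box (hf : IsGenerator f) (hg : IsGenerator g) {u v : ℝ}
    (hu : u ∈ Icc (0 : ℝ) 1) (hv : v ∈ Icc (0 : ℝ) 1) :
    inducedMeasure f g (Icc 0 u ×ˢ Icc 0 v) = ENNReal.ofReal (copula f g u v) := by
  have hm : MeasurableSet {s | threshold f g s ≤ v} :=
    measurableSet_le (measurable_threshold hf hg) measurable_const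
  have hcm : Measurable fun s => if threshold f g s ≤ v then curveDensity f g s else 0 :=
    Measurable.ite hm (measurable_curveDensity hf hg) measurable_const
  rw [inducedMeasure, Measure.add_apply, curveMeasure_box hf hg,
    withDensity_apply _ (measurableSet_Icc.prod measurableSet_Icc), Measure.volume_eq_prod,
    setLIntegral_prod _ (measurable_regionDensity hf hg).aemeasurable,
    ← restrict_Ioc_eq_restrict_Icc, ← lintegral_add_left hcm, ← lintegral_deriv_copula hf hg hu hv]
  refine lintegral_congr_ae ((ae_restrict_iff' measurableSet_Ioc).2 ?_)
  filter_upwards [hf.ae_differentiableAt_of_mem, ae_ne_real 1] with s h1 h2 h3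
  have hs : s ∈ Ioo (0 : ℝ) 1 := ⟨h3.1, lt_of_le_of_ne (h3.2.trans hu.2) h2⟩
  have hd := h1 ⟨hs.1.le, hs.2.le⟩
  rw [lintegral_regionDensity_section hf hg hs hd hv]
  split_ifs with h
  · have h4 := deriv_mul_le_of_threshold_le hf hg hs hd (threshold_lt_one hf hg s).le le_rfl
    -- This increment is the integral of the nonnegative density; with `h4` it allows jump and
    -- growth to be added inside `ENNReal.ofReal`, where they telescope to the slice derivative.
    have h5 : 0 ≤ (v - deriv f s * g v) -
        (threshold f g s - deriv f s * g (threshold f g s)) := by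
      rw [← (integral_standDensity_section hf hg hs hv.2 h).2, intervalIntegral.integral_of_le h]
      exact integral_nonneg_of_ae (standDensity_section_nonneg hf hg hs hd hv.2)
    rw [curveDensity, ← ENNReal.ofReal_add (sub_nonneg.2 h4) h5]
    congr 1
    ring
  · simp

/-! ### The stand and the zero set -/

lemma measurableSet_unitSquare : MeasurableSet unitSquare :=
  measurableSet_Icc.prod measurableSet_Icc

lemma interior_unitSquare : interior unitSquare = Ioo 0 1 ×ˢ Ioo 0 1 := by
  rw [unitSquare, interior_prod_eq, interior_Icc]

lemma stand_subset_unitSquare (C : ℝ → ℝ → ℝ) : stand C ⊆ unitSquare :=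
  closure_minimal (fun _ hp => hp.1) (isClosed_Icc.prod isClosed_Icc)

lemma zeroSet_subset_unitSquare (C : ℝ → ℝ → ℝ) : zeroSet C ⊆ unitSquare :=
  closure_minimal (fun _ hp => hp.1) (isClosed_Icc.prod isClosed_Icc)

/-- Near `p` there is a point of strict positivity still below and left of `q`. Its coordinates are
nonzero, as the copula vanishes on the axes, and positivity propagates upwards to `q`. -/
lemma mem_positiveRegion_of_lt (hf : IsGenerator f) (hg : IsGenerator g) {p q : ℝ × ℝ}
    (hp : p ∈ stand (copula f g)) (h1 : p.1 < q.1) (h2 : p.2 < q.2) (hq1 : q.1 < 1)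
    (hq2 : q.2 < 1) : q ∈ positiveRegion f g := by
  obtain ⟨x, ⟨hx1, hx2⟩, ⟨hxs1, hxs2⟩, hx⟩ := mem_closure_iff.1 hp (Iio q.1 ×ˢ Iio q.2)
    (isOpen_Iio.prod isOpen_Iio) ⟨h1, h2⟩
  have hpos : f x.1 * g x.2 < x.1 * x.2 := by
    rcases lt_max_iff.1 hx with h | h
    · exact absurd h (lt_irrefl _)
    · linarith
  have hx10 : 0 < x.1 := by
    refine lt_of_le_of_ne hxs1.1 fun h => ?_
    simp [← h, hf.map_zero] at hpos
  have hx20 : 0 < x.2 := by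
    refine lt_of_le_of_ne hxs2.1 fun h => ?_
    simp [← h, hg.map_zero] at hpos
  exact ⟨⟨hx10.trans hx1, hq1⟩, ⟨hx20.trans hx2, hq2⟩,
    hf.mul_lt_mul_of_le hg hx10 hx20 (le_of_lt hx1) (le_of_lt hx2) hq1.le hq2.le hpos⟩

lemma positiveRegion_subset_stand (f g : ℝ → ℝ) :
    positiveRegion f g ⊆ stand (copula f g) := by
  rintro p ⟨h1, h2, h⟩
  exact subset_closure ⟨⟨Ioo_subset_Icc_self h1, Ioo_subset_Icc_self h2⟩,
    lt_max_of_lt_right (sub_pos.2 h)⟩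

lemma interior_stand (hf : IsGenerator f) (hg : IsGenerator g) :
    interior (stand (copula f g)) = positiveRegion f g := by
  apply subset_antisymm
  · intro p hp
    have hp' : p ∈ Ioo (0 : ℝ) 1 ×ˢ Ioo (0 : ℝ) 1 := by
      rw [← interior_unitSquare]
      exact interior_mono (stand_subset_unitSquare _) hp
    -- Sliding an interior point slightly down the diagonal stays in the stand, and the original
    -- point is strictly above and to the right.
    have hc : Filter.Tendsto (fun t : ℝ => (p.1 - t, p.2 - t)) (nhdsWithin 0 (Ioi 0)) (nhds p) := by
      have : Continuous fun t : ℝ => (p.1 - t, p.2 - t) := by fun_prop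
      have h := this.tendsto 0
      simp only [sub_zero] at h
      exact h.mono_left nhdsWithin_le_nhds
    obtain ⟨t, ht, ht0⟩ := ((hc.eventually (isOpen_interior.mem_nhds hp)).and
      (self_mem_nhdsWithin : Ioi (0 : ℝ) ∈ nhdsWithin 0 (Ioi 0))).exists
    have ht0 : 0 < t := ht0
    exact mem_positiveRegion_of_lt hf hg (interior_subset ht) (sub_lt_self _ ht0)
      (sub_lt_self _ ht0) hp'.1.2 hp'.2.2
  · exact interior_maximal (positiveRegion_subset_stand f g) (isOpen_positiveRegion hf hg)

lemma disjoint_positiveRegion_zeroSet (hf : IsGenerator f) (hg : IsGenerator g) :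
    Disjoint (positiveRegion f g) (zeroSet (copula f g)) := by
  refine Disjoint.closure_right ?_ (isOpen_positiveRegion hf hg)
  rw [Set.disjoint_left]
  exact fun p hp hp' => hp'.2 (positiveRegion_subset_stand f g hp)

lemma copula_eq_zero_of_mem_interior_zeroSet (hf : IsGenerator f) (hg : IsGenerator g)
    {u v : ℝ} (h : (u, v) ∈ interior (zeroSet (copula f g))) : copula f g u v = 0 := by
  have h1 : (u, v) ∈ Ioo (0 : ℝ) 1 ×ˢ Ioo (0 : ℝ) 1 := by
    rw [← interior_unitSquare]
    exact interior_mono (zeroSet_subset_unitSquare _) h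
  refine max_eq_left (sub_nonpos.2 ?_)
  by_contra! h2
  exact Set.disjoint_left.1 (disjoint_positiveRegion_zeroSet hf hg) ⟨h1.1, h1.2, h2⟩
    (interior_subset h)

lemma threshold_mem_stand (hf : IsGenerator f) (hg : IsGenerator g) {s : ℝ}
    (hs : s ∈ Ioo (0 : ℝ) 1) : (s, threshold f g s) ∈ closure (positiveRegion f g) := by
  refine mem_closure_of_tendsto (b := nhdsWithin (threshold f g s) (Ioi (threshold f g s)))
    (f := fun v => (s, v)) ?_ ?_
  · exact ((Continuous.prodMk_right s).tendsto _).mono_left nhdsWithin_le_nhds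
  · filter_upwards [Ioo_mem_nhdsGT (threshold_lt_one hf hg s)] with v hv
    exact mem_positiveRegion_of_threshold_lt hf hg hs hv.2 hv.1

lemma threshold_mem_zeroSet (hf : IsGenerator f) (hg : IsGenerator g) {s : ℝ}
    (hs : s ∈ Ioo (0 : ℝ) 1) (h0 : 0 < threshold f g s) :
    (s, threshold f g s) ∈ zeroSet (copula f g) := by
  have h1 := threshold_lt_one hf hg s
  refine mem_closure_of_tendsto (b := nhdsWithin (0 : ℝ) (Ioi 0))
    (f := fun t => (s - t, threshold f g s - t)) ?_ ?_
  · have : Continuous fun t : ℝ => (s - t, threshold f g s - t) := by fun_prop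
    have h := this.tendsto 0
    simp only [sub_zero] at h
    exact h.mono_left nhdsWithin_le_nhds
  · filter_upwards [Ioo_mem_nhdsGT (lt_min hs.1 h0)] with t ht
    have ht1 := ht.2.trans_le (min_le_left _ _)
    have ht2 := ht.2.trans_le (min_le_right _ _)
    have ht0 := ht.1
    -- If a point diagonally below the curve were in the stand, the curve point would lie in the
    -- region, hence strictly above its own threshold.
    refine ⟨⟨⟨by linarith, by linarith [hs.2]⟩, ⟨by linarith, by linarith⟩⟩, fun h => ?_⟩
    have h2 := mem_positiveRegion_of_lt (q := (s, threshold f g s)) hf hg h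
      (sub_lt_self _ ht0) (sub_lt_self _ ht0) hs.2 h1
    exact lt_irrefl _ (threshold_lt_of_mem_positiveRegion hf hg h2)

lemma threshold_mem_innerBoundary (hf : IsGenerator f) (hg : IsGenerator g) {s : ℝ}
    (hs : s ∈ Ioo (0 : ℝ) 1) (h0 : 0 < threshold f g s) :
    (s, threshold f g s) ∈ innerBoundary (copula f g) :=
  ⟨⟨closure_minimal (positiveRegion_subset_stand f g) isClosed_closure
    (threshold_mem_stand hf hg hs), threshold_mem_zeroSet hf hg hs h0⟩, hs, h0,
    threshold_lt_one hf hg s⟩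

lemma threshold_notMem_interior_zeroSet (hf : IsGenerator f) (hg : IsGenerator g) {s : ℝ}
    (hs : s ∈ Ioo (0 : ℝ) 1) :
    (s, threshold f g s) ∉ interior (zeroSet (copula f g)) := by
  intro h
  obtain ⟨p, hp, hp'⟩ := mem_closure_iff.1 (threshold_mem_stand hf hg hs) _ isOpen_interior h
  exact Set.disjoint_left.1 (disjoint_positiveRegion_zeroSet hf hg) hp' (interior_subset hp)

lemma measurableSet_stand (C : ℝ → ℝ → ℝ) : MeasurableSet (stand C) :=
  isClosed_closure.measurableSet

/-- By Fubini it suffices to treat `s` where the antitone threshold is continuous. A stand point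
`(s,v)` below the curve would put `(s',w)` in the region for all `s' > s` and `w > v` in the open
square, forcing the threshold to drop immediately to the right of `s`. -/
lemma volume_stand_diff (hf : IsGenerator f) (hg : IsGenerator g) :
    volume (stand (copula f g) \ positiveRegion f g) = 0 := by
  have hm : MeasurableSet (stand (copula f g) \ positiveRegion f g) :=
    (measurableSet_stand _).diff (isOpen_positiveRegion hf hg).measurableSet
  rw [Measure.volume_eq_prod, Measure.measure_prod_null hm]
  filter_upwards [ae_ne_real 0, ae_ne_real 1,
    (antitoneOn_threshold hf hg).countable_not_continuousWithinAt.ae_notMem volume]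
    with s hs0 hs1 hsc
  rw [Pi.zero_apply, ← nonpos_iff_eq_zero]
  have hsub : Prod.mk s ⁻¹' (stand (copula f g) \ positiveRegion f g) ⊆
      {0, 1, threshold f g s} := by
    rintro v ⟨hv1, hv2⟩
    by_contra hv
    simp only [mem_insert_iff, mem_singleton_iff, not_or] at hv
    have hsq := stand_subset_unitSquare _ hv1
    have hs : s ∈ Ioo (0 : ℝ) 1 :=
      ⟨lt_of_le_of_ne hsq.1.1 (Ne.symm hs0), lt_of_le_of_ne hsq.1.2 hs1⟩
    have hv01 : v ∈ Ioo (0 : ℝ) 1 :=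
      ⟨lt_of_le_of_ne hsq.2.1 (Ne.symm hv.1), lt_of_le_of_ne hsq.2.2 hv.2.1⟩
    have hlt : v < threshold f g s := lt_of_le_of_ne
      (not_lt.1 fun h => hv2 (mem_positiveRegion_of_threshold_lt hf hg hs hv01.2 h)) hv.2.2
    obtain ⟨w, hvw, hw⟩ := exists_between hlt
    have hcont : ContinuousAt (threshold f g) s := by
      have : ContinuousWithinAt (threshold f g) (Ioo 0 1) s := by
        by_contra h
        exact hsc ⟨hs, h⟩
      exact this.continuousAt (Ioo_mem_nhds hs.1 hs.2)
    obtain ⟨s', hs', hs'1⟩ := (((hcont.eventually (lt_mem_nhds hw)).filter_mono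
      nhdsWithin_le_nhds).and (Ioo_mem_nhdsGT hs.2)).exists
    have h1 := mem_positiveRegion_of_lt (q := (s', w)) hf hg hv1 hs'1.1 hvw hs'1.2
      (hw.trans (threshold_lt_one hf hg s))
    exact lt_asymm hs' (threshold_lt_of_mem_positiveRegion hf hg h1)
  exact (measure_mono hsub).trans (by rw [(toFinite _).measure_zero])

/-! ### Existence and uniqueness of the induced measure -/

lemma curveMeasure_eq_zero (hf : IsGenerator f) (hg : IsGenerator g) {A : Set (ℝ × ℝ)}
    (hA : MeasurableSet A)
    (h : ∀ s ∈ Ioo (0 : ℝ) 1, 0 < threshold f g s → (s, threshold f g s) ∉ A) :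
    curveMeasure f g A = 0 := by
  rw [curveMeasure_apply hf hg hA,
    setLIntegral_congr_fun (g := 0) (measurable_id'.prodMk (measurable_threshold hf hg) hA) ?_]
  · simp
  · intro s hs
    rcases (threshold_nonneg f g s).eq_or_lt with h0 | h0
    -- Where the curve lies on the axis its density is `0 - f'(s)g(0) = 0`.
    · simp [curveDensity, ← h0, hg.map_zero]
    · have hs1 : s ∈ Ioo (0 : ℝ) 1 := by
        by_contra hs1
        exact h0.ne' (threshold_eq_zero hs1)
      exact absurd hs (h s hs1 h0)

lemma mutuallySingular_curveMeasure (hf : IsGenerator f) (hg : IsGenerator g) :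
    curveMeasure f g ⟂ₘ volume := by
  have hm : MeasurableSet {p : ℝ × ℝ | p.2 = threshold f g p.1} :=
    measurableSet_eq_fun measurable_snd ((measurable_threshold hf hg).comp measurable_fst)
  refine ⟨_, hm.compl, curveMeasure_eq_zero hf hg hm.compl fun s _ _ h => h rfl, ?_⟩
  rw [compl_compl, Measure.volume_eq_prod, Measure.measure_prod_null hm]
  refine Filter.Eventually.of_forall fun s => ?_
  have : Prod.mk s ⁻¹' {p : ℝ × ℝ | p.2 = threshold f g p.1} = {threshold f g s} := by
    ext v
    rfl
  simp [this]

lemma regionDensity_eq_zero {A : Set (ℝ × ℝ)} (hA : MeasurableSet A)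
    (h : Disjoint (positiveRegion f g) A) : volume.withDensity (regionDensity f g) A = 0 := by
  rw [withDensity_apply _ hA, setLIntegral_congr_fun (g := 0) hA]
  · simp
  · intro p hp
    exact indicator_of_notMem (fun h' => Set.disjoint_left.1 h h' hp) _

lemma isInducedBy_inducedMeasure (hf : IsGenerator f) (hg : IsGenerator g) :
    IsInducedBy (inducedMeasure f g) (copula f g) where
  compl_null := by
    have hm := measurableSet_unitSquare.compl
    rw [inducedMeasure, Measure.add_apply, curveMeasure_eq_zero hf hg hm, regionDensity_eq_zero hm,
      add_zero]
    · exact Set.disjoint_left.2 fun p hp hp' =>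
        hp' ⟨Ioo_subset_Icc_self hp.1, Ioo_subset_Icc_self hp.2.1⟩
    · exact fun s hs _ h => h ⟨Ioo_subset_Icc_self hs, threshold_mem_Icc hf hg s⟩
  apply_box _ hu _ hv := inducedMeasure_box hf hg hu hv

lemma IsInducedBy.isFiniteMeasure {μ : Measure (ℝ × ℝ)} {C : ℝ → ℝ → ℝ} (h : IsInducedBy μ C) :
    IsFiniteMeasure μ := by
  refine ⟨?_⟩
  rw [← measure_add_measure_compl measurableSet_unitSquare, h.compl_null, add_zero]
  exact (h.apply_box 1 (by simp) 1 (by simp)).trans_lt ENNReal.ofReal_lt_top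

/-- The lower-left quadrants form a generating π-system, and concentration on the square turns each
quadrant into a box `[0,u] × [0,v]` or the empty set. -/
lemma IsInducedBy.eq {μ ν : Measure (ℝ × ℝ)} {C : ℝ → ℝ → ℝ} (hμ : IsInducedBy μ C)
    (hν : IsInducedBy ν C) : μ = ν := by
  have := hμ.isFiniteMeasure
  have hspan : IsCountablySpanning (range (Iic : ℝ → Set ℝ)) :=
    ⟨fun n : ℕ => Iic (n : ℝ), fun n => mem_range_self _, by
      refine eq_univ_of_forall fun x => mem_iUnion.2 ?_
      exact exists_nat_ge x⟩
  have hgen : MeasurableSpace.generateFrom (range (Iic : ℝ → Set ℝ)) = Real.measurableSpace :=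
    (borel_eq_generateFrom_Iic ℝ).symm.trans (BorelSpace.measurable_eq (α := ℝ)).symm
  have hcompl : ∀ {ρ : Measure (ℝ × ℝ)}, IsInducedBy ρ C → ∀ A, ρ A = ρ (A ∩ unitSquare) :=
    fun hρ A => (measure_inter_conull hρ.compl_null).symm
  refine ext_of_generate_finite _ (generateFrom_eq_prod hgen hgen hspan hspan).symm
    (isPiSystem_Iic.prod isPiSystem_Iic) ?_ ?_
  · rintro _ ⟨_, ⟨a, rfl⟩, _, ⟨b, rfl⟩, rfl⟩
    simp only
    rw [hcompl hμ, hcompl hν]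
    have h1 : Iic a ×ˢ Iic b ∩ unitSquare = Icc 0 (min a 1) ×ˢ Icc 0 (min b 1) := by
      ext p
      simp only [unitSquare, mem_inter_iff, mem_prod, mem_Iic, mem_Icc, le_min_iff]
      tauto
    rw [h1]
    by_cases hab : 0 ≤ a ∧ 0 ≤ b
    · have ha : min a 1 ∈ Icc (0 : ℝ) 1 := ⟨le_min hab.1 zero_le_one, min_le_right _ _⟩
      have hb : min b 1 ∈ Icc (0 : ℝ) 1 := ⟨le_min hab.2 zero_le_one, min_le_right _ _⟩
      rw [hμ.apply_box _ ha _ hb, hν.apply_box _ ha _ hb]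
    · have h2 : Icc (0 : ℝ) (min a 1) ×ˢ Icc (0 : ℝ) (min b 1) = ∅ := by
        rw [prod_eq_empty_iff]
        rcases not_and_or.1 hab with h | h
        · exact Or.inl (Icc_eq_empty fun h' => h (h'.trans (min_le_left _ _)))
        · exact Or.inr (Icc_eq_empty fun h' => h (h'.trans (min_le_left _ _)))
      rw [h2, measure_empty, measure_empty]
  · rw [hcompl hμ, hcompl hν, univ_inter]
    exact (hμ.apply_box 1 (by simp) 1 (by simp)).trans (hν.apply_box 1 (by simp) 1 (by simp)).symm

lemma singularPart_inducedMeasure (hf : IsGenerator f) (hg : IsGenerator g) :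
    (inducedMeasure f g).singularPart volume = curveMeasure f g :=
  (Measure.eq_singularPart (measurable_regionDensity hf hg)
    (mutuallySingular_curveMeasure hf hg) rfl).symm

lemma rnDeriv_inducedMeasure (hf : IsGenerator f) (hg : IsGenerator g) :
    (inducedMeasure f g).rnDeriv volume =ᵐ[volume] regionDensity f g :=
  (Measure.eq_rnDeriv (measurable_regionDensity hf hg)
    (mutuallySingular_curveMeasure hf hg) rfl).symm

lemma restrict_inducedMeasure_absolutelyContinuous {A : Set (ℝ × ℝ)} (h : curveMeasure f g A = 0) :
    (inducedMeasure f g).restrict A ≪ volume := by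
  rw [inducedMeasure, Measure.restrict_add, Measure.restrict_eq_zero.2 h, zero_add]
  exact Measure.absolutelyContinuous_of_le Measure.restrict_le_self |>.trans
    (withDensity_absolutelyContinuous _ _)

lemma measurableSet_innerBoundary (C : ℝ → ℝ → ℝ) : MeasurableSet (innerBoundary C) :=
  ((measurableSet_stand C).inter isClosed_closure.measurableSet).inter
    (measurableSet_Ioo.prod measurableSet_Ioo)

lemma curveMeasure_compl_levelZero (hf : IsGenerator f) (hg : IsGenerator g) :
    curveMeasure f g (levelZero (copula f g))ᶜ = 0 := by
  have h1 : curveMeasure f g (innerBoundary (copula f g))ᶜ = 0 :=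
    curveMeasure_eq_zero hf hg (measurableSet_innerBoundary _).compl
      fun s hs h0 h => h (threshold_mem_innerBoundary hf hg hs h0)
  -- If the inner boundary is empty, `h1` already says that the curve measure is zero, so the other
  -- branch of `levelZero` plays no role.
  refine measure_mono_null (compl_subset_compl.2 fun p hp => ?_) h1
  rwa [levelZero, if_pos ⟨p, hp⟩]

/-! ### Consequences for the density -/

lemma ae_mem_positiveRegion_of_mem_stand (hf : IsGenerator f) (hg : IsGenerator g) :
    ∀ᵐ p ∂(volume.restrict (stand (copula f g))), p ∈ positiveRegion f g := by
  rw [ae_restrict_iff' (measurableSet_stand _)]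
  filter_upwards [measure_eq_zero_iff_ae_notMem.1 (volume_stand_diff hf hg)] with p hp hps
  by_contra h
  exact hp ⟨hps, h⟩

lemma ae_standDensity_nonneg (hf : IsGenerator f) (hg : IsGenerator g) :
    ∀ᵐ p ∂(volume.restrict (stand (copula f g))), 0 ≤ standDensity f g p := by
  have h1 : ∀ᵐ p : ℝ × ℝ, p.1 ∈ Icc (0 : ℝ) 1 → DifferentiableAt ℝ f p.1 :=
    Measure.quasiMeasurePreserving_fst.ae hf.ae_differentiableAt_of_mem
  have h2 : ∀ᵐ p : ℝ × ℝ, p.2 ∈ Icc (0 : ℝ) 1 → DifferentiableAt ℝ g p.2 :=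
    Measure.quasiMeasurePreserving_snd.ae hg.ae_differentiableAt_of_mem
  filter_upwards [ae_mem_positiveRegion_of_mem_stand hf hg, ae_restrict_of_ae h1,
    ae_restrict_of_ae h2] with p hp hp1 hp2
  exact standDensity_nonneg hf hg hp (hp1 (Ioo_subset_Icc_self hp.1))
    (hp2 (Ioo_subset_Icc_self hp.2.1))

lemma integrableOn_standDensity (hf : IsGenerator f) (hg : IsGenerator g) :
    IntegrableOn (standDensity f g) (stand (copula f g)) volume := by
  refine ⟨(measurable_standDensity f g).aestronglyMeasurable, ?_⟩
  rw [hasFiniteIntegral_iff_ofReal (ae_standDensity_nonneg hf hg)]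
  have := (isInducedBy_inducedMeasure hf hg).isFiniteMeasure
  calc ∫⁻ p in stand (copula f g), ENNReal.ofReal (standDensity f g p)
      = ∫⁻ p in stand (copula f g), regionDensity f g p := by
        refine lintegral_congr_ae ?_
        filter_upwards [ae_mem_positiveRegion_of_mem_stand hf hg] with p hp
        rw [regionDensity, indicator_of_mem hp]
    _ = volume.withDensity (regionDensity f g) (stand (copula f g)) :=
        (withDensity_apply _ (measurableSet_stand _)).symm
    _ ≤ inducedMeasure f g (stand (copula f g)) := by
        rw [inducedMeasure, Measure.add_apply]
        exact le_add_self
    _ < ∞ := measure_lt_top _ _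

lemma IsGenerator.integral_deriv (hf : IsGenerator f) {a c : ℝ} (ha : 0 < a) (hac : a ≤ c)
    (hc : c ≤ 1) : IntegrableOn (deriv f) (Icc a c) ∧ ∫ x in Icc a c, deriv f x = f c - f a := by
  obtain ⟨M, hM⟩ := hf.exists_lipschitzOnWith ha
  have h : AbsolutelyContinuousOnInterval f a c := by
    apply LipschitzOnWith.absolutelyContinuousOnInterval
    rw [uIcc_of_le hac]
    exact hM.mono (Icc_subset_Icc_right hc)
  refine ⟨(intervalIntegrable_iff_integrableOn_Icc_of_le hac).1 h.intervalIntegrable_deriv, ?_⟩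
  rw [integral_Icc_eq_integral_Ioc, ← intervalIntegral.integral_of_le hac, h.integral_deriv_eq_sub]

/-- Inside the region the maximum is inactive and `a, b > 0`, so both generators are Lipschitz on
the sides and the product `f'(u)g'(v)` integrates to the product of their increments. -/
lemma integral_standDensity_rectangle (hf : IsGenerator f) (hg : IsGenerator g) {a b c d : ℝ}
    (hac : a ≤ c) (hbd : b ≤ d)
    (h : Icc a c ×ˢ Icc b d ⊆ interior (stand (copula f g))) :
    ∫ p in Icc a c ×ˢ Icc b d, standDensity f g p =
      copula f g c d - copula f g c b - copula f g a d + copula f g a b := by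
  rw [interior_stand hf hg] at h
  have hC : ∀ x ∈ Icc a c, ∀ y ∈ Icc b d, copula f g x y = x * y - f x * g y :=
    fun x hx y hy => max_eq_right (sub_nonneg.2 (h (mk_mem_prod hx hy)).2.2.le)
  have ha := left_mem_Icc.2 hac
  have hb := left_mem_Icc.2 hbd
  have hc := right_mem_Icc.2 hac
  have hd := right_mem_Icc.2 hbd
  have h1 := h (mk_mem_prod ha hb)
  have h2 := h (mk_mem_prod hc hd)
  obtain ⟨hfi, hfe⟩ := hf.integral_deriv h1.1.1 hac h2.1.2.le
  obtain ⟨hgi, hge⟩ := hg.integral_deriv h1.2.1.1 hbd h2.2.1.2.le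
  have hfg : IntegrableOn (fun p : ℝ × ℝ => deriv f p.1 * deriv g p.2)
      (Icc a c ×ˢ Icc b d) volume := by
    rw [IntegrableOn, Measure.volume_eq_prod, ← Measure.prod_restrict]
    exact Integrable.mul_prod hfi hgi
  have hone : IntegrableOn (fun _ : ℝ × ℝ => (1 : ℝ)) (Icc a c ×ˢ Icc b d) volume :=
    integrableOn_const (isCompact_Icc.prod isCompact_Icc).measure_lt_top.ne
  simp only [standDensity]
  rw [integral_sub hone hfg, Measure.volume_eq_prod, setIntegral_prod_mul, hfe, hge,
    setIntegral_const, measureReal_prod_prod, Real.volume_real_Icc_of_le hac,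
    Real.volume_real_Icc_of_le hbd, hC a ha b hb, hC a ha d hd, hC c hc b hb, hC c hc d hd,
    smul_eq_mul]
  ring

end RMM

theorem mainTheorem3 (f g : ℝ → ℝ) (hf : RMM.IsGenerator f) (hg : RMM.IsGenerator g) :
    -- `C_{f,g}` induces a unique measure
    (∃! μ : Measure (ℝ × ℝ), RMM.IsInducedBy μ (RMM.copula f g)) ∧
    -- the density `1 - f' g'` makes sense a.e., is nonnegative a.e. and integrable on the stand
    (∀ᵐ u ∂(volume.restrict (Icc (0 : ℝ) 1)), DifferentiableAt ℝ f u) ∧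
    (∀ᵐ v ∂(volume.restrict (Icc (0 : ℝ) 1)), DifferentiableAt ℝ g v) ∧
    (∀ᵐ p ∂(volume.restrict (RMM.stand (RMM.copula f g))), 0 ≤ RMM.standDensity f g p) ∧
    IntegrableOn (RMM.standDensity f g) (RMM.stand (RMM.copula f g)) volume ∧
    -- the volume formula on rectangles in the interior of the stand and of the zero set
    (∀ a b c d : ℝ, a ≤ c → b ≤ d →
      Icc a c ×ˢ Icc b d ⊆ interior (RMM.stand (RMM.copula f g)) →
      ∫ p in Icc a c ×ˢ Icc b d, RMM.standDensity f g p =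
        RMM.copula f g c d - RMM.copula f g c b - RMM.copula f g a d + RMM.copula f g a b) ∧
    (∀ a b c d : ℝ, a ≤ c → b ≤ d →
      Icc a c ×ˢ Icc b d ⊆ interior (RMM.zeroSet (RMM.copula f g)) →
      RMM.copula f g c d - RMM.copula f g c b - RMM.copula f g a d + RMM.copula f g a b = 0) ∧
    -- the induced measure: absolute continuity, density, location of the singular part
    (∀ μ : Measure (ℝ × ℝ), RMM.IsInducedBy μ (RMM.copula f g) →
      μ.restrict (interior (RMM.stand (RMM.copula f g))) ≪ volume ∧
      μ.restrict (interior (RMM.zeroSet (RMM.copula f g))) ≪ volume ∧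
      μ.rnDeriv volume =ᵐ[volume.restrict (RMM.stand (RMM.copula f g))]
        (fun p => ENNReal.ofReal (RMM.standDensity f g p)) ∧
      μ.rnDeriv volume =ᵐ[volume.restrict (RMM.zeroSet (RMM.copula f g))] (fun _ => 0) ∧
      μ.singularPart volume (RMM.levelZero (RMM.copula f g))ᶜ = 0) := by
  refine ⟨⟨RMM.inducedMeasure f g, RMM.isInducedBy_inducedMeasure hf hg,
    fun μ hμ => hμ.eq (RMM.isInducedBy_inducedMeasure hf hg)⟩, hf.ae_differentiableAt,
    hg.ae_differentiableAt, RMM.ae_standDensity_nonneg hf hg, RMM.integrableOn_standDensity hf hg,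
    fun a b c d hac hbd h => RMM.integral_standDensity_rectangle hf hg hac hbd h,
    fun a b c d hac hbd h => ?_, fun μ hμ => ?_⟩
  · have hC : ∀ x ∈ Icc a c, ∀ y ∈ Icc b d, RMM.copula f g x y = 0 := fun x hx y hy =>
      RMM.copula_eq_zero_of_mem_interior_zeroSet hf hg (h (mk_mem_prod hx hy))
    have ha := left_mem_Icc.2 hac
    have hb := left_mem_Icc.2 hbd
    have hc := right_mem_Icc.2 hac
    have hd := right_mem_Icc.2 hbd
    rw [hC a ha b hb, hC a ha d hd, hC c hc b hb, hC c hc d hd]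
    norm_num
  · obtain rfl := hμ.eq (RMM.isInducedBy_inducedMeasure hf hg)
    refine ⟨?_, ?_, ?_, ?_, ?_⟩
    · refine RMM.restrict_inducedMeasure_absolutelyContinuous ?_
      refine RMM.curveMeasure_eq_zero hf hg isOpen_interior.measurableSet fun s _ _ h => ?_
      rw [RMM.interior_stand hf hg] at h
      exact lt_irrefl _ (RMM.threshold_lt_of_mem_positiveRegion hf hg h)
    · exact RMM.restrict_inducedMeasure_absolutelyContinuous (RMM.curveMeasure_eq_zero hf hg
          isOpen_interior.measurableSet
          fun s hs _ => RMM.threshold_notMem_interior_zeroSet hf hg hs)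
    · filter_upwards [ae_restrict_of_ae (RMM.rnDeriv_inducedMeasure hf hg),
        RMM.ae_mem_positiveRegion_of_mem_stand hf hg] with p hp hp'
      rw [hp, RMM.regionDensity, indicator_of_mem hp']
    · filter_upwards [ae_restrict_of_ae (RMM.rnDeriv_inducedMeasure hf hg),
        ae_restrict_mem isClosed_closure.measurableSet] with p hp hp'
      rw [hp]
      exact indicator_of_notMem
        (fun h => Set.disjoint_left.1 (RMM.disjoint_positiveRegion_zeroSet hf hg) h hp') _
    · rw [RMM.singularPart_inducedMeasure hf hg]
      exact RMM.curveMeasure_compl_levelZero hf hg
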